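/- Let $d\ge 1$, $\xi\in\mathbb{R}^d$, let $\bar\Omega$ be a positive definite $d\times d$ matrix, and let $\tilde f:[0,\infty)\to[0,\infty)$ be a density generator, i.e. a measurable function with $0<\int_{\mathbb{R}^d}\tilde f(\|y\|^2)\,dy<\infty$; put $c_d=\left(\int_{\mathbb{R}^d}\tilde f(\|y\|^2)\,dy\right)^{-1}$. Let $f(z)=c_d|\bar\Omega|^{-1/2}\tilde f\{(z-\xi)^\top\bar\Omega^{-1}(z-\xi)\}$ be the density of $U\sim \mathrm{Ell}_d(\xi,\bar\Omega,\tilde f)$. Let $X$ be a real random variable with distribution function $G$ such that $G(-x)=1-G(x)$ for all $x\in\mathbb{R}$, and let $w:\mathbb{R}^d\to\mathbb{R}$ be measurable with $w(-y)=-w(y)$ for all $y$. Let $Z$ be a random vector with density $2f(z)\,G\{w(z-\xi)\}$, $z\in\mathbb{R}^d$, and let $L$ be any $d\times d$ matrix with $L^\top L=\bar\Omega$. Write $w_L(y)=w(L^\top y)$. Then there are random variables $R>0$ and $S'$, on the probability space of $Z$, with $\|S'\|=1$ and $$Z=\xi+R\,L^\top S'\quad\text{almost surely,}$$ such that the following hold.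 (a) $R$ has the same distribution as the radius of $U$: if $S$ is uniform on the unit sphere of $\mathbb{R}^d$ and independent of a variable $R_0$ with the law of $R$, then $\xi+R_0L^\top S$ has the law of $U$; and whenever $\xi+R_0L_0^\top S$ has the law of $U$, with $L_0^\top L_0=\bar\Omega$, $S$ uniform on the unit sphere and $R_0>0$ almost surely and independent of $S$, then $R_0$ has the law of $R$. (b) Relative to the uniform distribution on the unit sphere, $S'$ has density $s\mapsto 2\Pr\{X\le w_L(Rs)\}$, where $X$ is independent of $R$. Hence $S'$ is in general not uniform: it is uniform if and only if $\Pr\{X\le w_L(Rs)\}=\tfrac12$ for almost every $s$ in the sphere. If $d\ge2$, then in spherical coordinates $s(\theta)=(\cos\theta_1,\ \sin\theta_1\cos\theta_2,\ \dots,\ \sin\theta_1\cdots\sin\theta_{d-2}\cos\theta_{d-1},\ \sin\theta_1\cdots\sin\theta_{d-1})$, with $\theta_k\in[0,\pi)$ for $k\le d-2$ and $\theta_{d-1}\in[0,2\pi)$, the density of $S'$ is $$\frac{\Gamma(d/2)}{\pi^{d/2}}\prod_{k=1}^{d-2}(\sin\theta_k)^{d-k-1}\,\Pr\{X\le w_L^*(\theta_1,\dots,\theta_{d-1},R)\},\qquad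 w_L^*(\theta,r)=w_L(r\,s(\theta)).$$ (c) For almost every $r$ with respect to the law of $R$, the conditional distribution of $S'$ given $R=r$ is again a perturbation of a centrally symmetric distribution of the same type: relative to the uniform distribution on the unit sphere, which is symmetric around $0$, it has density $s\mapsto 2\,G\{w_L(rs)\}$, where $s\mapsto w_L(rs)$ is odd. If $d\ge2$, its density in spherical coordinates is $$\frac{\Gamma(d/2)}{\pi^{d/2}}\prod_{k=1}^{d-2}(\sin\theta_k)^{d-k-1}\,G\{w_L^*(\theta_1,\dots,\theta_{d-1},r)\}.$$ -/

import Mathlib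

open MeasureTheory ProbabilityTheory Set Matrix

noncomputable section

/-- Euclidean space `ℝ^d`. -/
abbrev E (d : ℕ) : Type := EuclideanSpace ℝ (Fin d)

/-- The matrix-vector product `A x` on `ℝ^d`. -/
def act {d : ℕ} (A : Matrix (Fin d) (Fin d) ℝ) (x : E d) : E d :=
  WithLp.toLp 2 (A *ᵥ x.ofLp)

/-- The quadratic form `xᵀ A x`. -/
def quad {d : ℕ} (A : Matrix (Fin d) (Fin d) ℝ) (x : E d) : ℝ :=
  x.ofLp ⬝ᵥ (A *ᵥ x.ofLp)

/-- `ft : ℝ⁺ → ℝ⁺` generates a density on `ℝ^d`: `y ↦ ft (‖y‖²)` can be normalised. Only the values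
of `ft` on `[0, ∞)` are ever used. -/
structure IsDensityGenerator (d : ℕ) (ft : ℝ → ℝ) : Prop where
  measurable : Measurable ft
  nonneg : ∀ x, 0 ≤ x → 0 ≤ ft x
  integrable : Integrable (fun y : E d => ft (‖y‖ ^ 2)) volume
  pos : 0 < ∫ y : E d, ft (‖y‖ ^ 2)

/-- The normalising constant `c_d` of a density generator. -/
def normConst (d : ℕ) (ft : ℝ → ℝ) : ℝ := (∫ y : E d, ft (‖y‖ ^ 2))⁻¹

/-- The density of `Ell_d(ξ, Om, ft)`. -/
def ellDensity {d : ℕ} (ξ : E d) (Om : Matrix (Fin d) (Fin d) ℝ) (ft : ℝ → ℝ) (y : E d) : ℝ :=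
  normConst d ft / Real.sqrt Om.det * ft (quad Om⁻¹ (y - ξ))

/-- The distribution `Ell_d(ξ, Om, ft)`. -/
def ellLaw {d : ℕ} (ξ : E d) (Om : Matrix (Fin d) (Fin d) ℝ) (ft : ℝ → ℝ) : Measure (E d) :=
  volume.withDensity (fun y => ENNReal.ofReal (ellDensity ξ Om ft y))

/-- The uniform distribution on the unit sphere of `ℝ^d`, as a measure on `ℝ^d`: the normalised
surface measure. -/
def unifSphere (d : ℕ) : Measure (E d) :=
  (((volume : Measure (E d)).toSphere univ)⁻¹ • (volume : Measure (E d)).toSphere).map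
    (Subtype.val : Metric.sphere (0 : E d) 1 → E d)

/-- `ρ` is the law of a radius (generating variate) in a representation `ξ + R Lᵀ S` of the
distribution `μ`, where `R > 0` almost surely and `S` is uniform on the unit sphere and independent
of `R`. -/
def IsRadiusLaw {d : ℕ} (ξ : E d) (L : Matrix (Fin d) (Fin d) ℝ) (μ : Measure (E d))
    (ρ : Measure ℝ) : Prop :=
  IsProbabilityMeasure ρ ∧ ρ (Iic 0) = 0 ∧
    (ρ.prod (unifSphere d)).map (fun p => ξ + p.1 • act Lᵀ p.2) = μ

/-- `μ` is obtained from the probability distribution `μ₀`, centrally symmetric around `0`, by the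
perturbation `2 G(v)`, where `v` is odd: if `μ₀` has density `f` with respect to some measure, then
`μ` has density `2 f G(v)` with respect to it. -/
def IsSymmetricPerturbation {d : ℕ} (μ₀ : Measure (E d)) (G : ℝ → ℝ) (v : E d → ℝ)
    (μ : Measure (E d)) : Prop :=
  IsProbabilityMeasure μ₀ ∧ μ₀.map (fun y => -y) = μ₀ ∧
    Measurable v ∧ (∀ y, v (-y) = -v y) ∧
    IsProbabilityMeasure μ ∧ μ = μ₀.withDensity (fun y => ENNReal.ofReal (2 * G (v y)))

/-- The point of the unit sphere of `ℝ^d` with spherical coordinates `θ₁, …, θ_{d-1}`: its `j`-th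
coordinate is `sin θ₁ ⋯ sin θ_{j-1} cos θ_j` for `j < d`, and the last one is
`sin θ₁ ⋯ sin θ_{d-1}`. (Indices start from `0` in the code.) -/
def sphPoint {d : ℕ} (θ : Fin (d - 1) → ℝ) : E d :=
  WithLp.toLp 2 fun j : Fin d =>
    (∏ k : Fin (d - 1), if k.val < j.val then Real.sin (θ k) else 1) *
      (if h : j.val < d - 1 then Real.cos (θ ⟨j.val, h⟩) else 1)

/-- The range of the angles: `θ_k ∈ [0, π)` for `k ≤ d - 2`, and `θ_{d-1} ∈ [0, 2π)`. -/
def angleBox (d : ℕ) : Set (Fin (d - 1) → ℝ) :=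
  {θ | ∀ k : Fin (d - 1), θ k ∈ Ico 0 (if k.val + 1 = d - 1 then 2 * Real.pi else Real.pi)}

/-- The angular part `∏_{k=1}^{d-2} (sin θ_k)^{d-k-1}` of the Jacobian. (The index `k` in the code is
one less, and the factor for the last angle is `1`.) -/
def angleJacobian {d : ℕ} (θ : Fin (d - 1) → ℝ) : ℝ :=
  ∏ k : Fin (d - 1), Real.sin (θ k) ^ (d - 2 - k.val)

/-- In spherical coordinates, the distribution `μ` on the unit sphere has density `h`. -/
def HasSphericalDensity {d : ℕ} (μ : Measure (E d)) (h : (Fin (d - 1) → ℝ) → ℝ) : Prop :=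
  μ = ((volume.restrict (angleBox d)).withDensity (fun θ => ENNReal.ofReal (h θ))).map sphPoint

/-- `w_L(y) = w(Lᵀ y)`. -/
def wL {d : ℕ} (w : E d → ℝ) (L : Matrix (Fin d) (Fin d) ℝ) (y : E d) : ℝ := w (act Lᵀ y)

/-- `w_L^*(θ₁, …, θ_{d-1}, r)`: the function `w_L` in spherical coordinates. -/
def wLStar {d : ℕ} (w : E d → ℝ) (L : Matrix (Fin d) (Fin d) ℝ) (θ : Fin (d - 1) → ℝ) (r : ℝ) : ℝ :=
  wL w L (r • sphPoint θ)

end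

/-!
Up to null sets, `(r, s) ↦ ξ + r • Lᵀ s` is an isomorphism of the product of the radius law and the
uniform law on the sphere onto the elliptical law. The law of `Z` has density `2 G(w(z - ξ))`
relative to the elliptical law, so the pair `(R, S')` obtained from `Z` by the inverse map has
density `2 G(w_L(r s))` relative to this product. For each `r`, `s ↦ w_L(r s)` is odd, hence
`G(w_L(r s)) + G(w_L(-r s)) = 1` and the density integrates to `1` over the sphere: the law of
`R` is not perturbed, and `s ↦ 2 G(w_L(r s))` is the conditional density of `S'` given `R = r`.
Averaging it over `r` gives the law of `S'`.

The spherical coordinates of the surface measure are found by iterating planar polar coordinates,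
which splits Lebesgue measure into the radial measure `r ^ (d - 1) dr` and an angular measure. Since
a measure on the sphere is determined by its product with the radial measure, comparing this with
the splitting of Lebesgue measure into radial and surface measure transports one onto the other.
-/

section Measures

open scoped ENNReal

variable {α β : Type*} {mα : MeasurableSpace α} {mβ : MeasurableSpace β}

theorem map_withDensity_comp (μ : Measure α) {φ : α → β} (hφ : Measurable φ) {g : β → ℝ≥0∞}
    (hg : Measurable g) :
    (μ.withDensity fun x => g (φ x)).map φ = (μ.map φ).withDensity g := by
  ext s hs
  rw [Measure.map_apply hφ hs, withDensity_apply _ (hφ hs), withDensity_apply _ hs,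
    setLIntegral_map hs hg hφ]

theorem eq_of_prod_eq_prod_left {ρ : Measure α} [SigmaFinite ρ] (hρ : ρ ≠ 0) {σ τ : Measure β}
    [SFinite σ] [SFinite τ] (h : ρ.prod σ = ρ.prod τ) : σ = τ := by
  obtain ⟨n, hn⟩ : ∃ n, 0 < ρ (spanningSets ρ n) :=
    exists_measure_pos_of_not_measure_iUnion_null
      (by rwa [iUnion_spanningSets, Measure.measure_univ_ne_zero])
  ext s -
  have hs := congrArg (fun m : Measure (α × β) => m (spanningSets ρ n ×ˢ s)) h
  simp only [Measure.prod_prod] at hs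
  exact (ENNReal.mul_right_inj hn.ne' (measure_spanningSets_lt_top ρ n).ne).1 hs

theorem map_fst_prod_withDensity (ρ : Measure α) [SFinite ρ] (σ : Measure β) [SFinite σ]
    {k : α × β → ℝ≥0∞} (hk : Measurable k) :
    ((ρ.prod σ).withDensity k).map Prod.fst = ρ.withDensity fun a => ∫⁻ b, k (a, b) ∂σ := by
  ext s hs
  rw [Measure.map_apply measurable_fst hs, withDensity_apply _ (measurable_fst hs),
    withDensity_apply _ hs, ← prod_univ, ← Measure.prod_restrict, Measure.restrict_univ,
    lintegral_prod _ hk.aemeasurable]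

theorem map_snd_prod_withDensity (ρ : Measure α) [SFinite ρ] (σ : Measure β) [SFinite σ]
    {k : α × β → ℝ≥0∞} (hk : Measurable k) :
    ((ρ.prod σ).withDensity k).map Prod.snd = σ.withDensity fun b => ∫⁻ a, k (a, b) ∂ρ := by
  ext s hs
  rw [Measure.map_apply measurable_snd hs, withDensity_apply _ (measurable_snd hs),
    withDensity_apply _ hs, ← univ_prod, ← Measure.prod_restrict, Measure.restrict_univ,
    lintegral_prod_symm' _ hk]

theorem withDensity_two_mul_eq_self_iff {σ : Measure α} [SigmaFinite σ] {p : α → ℝ}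
    (hp : Measurable p) :
    σ.withDensity (fun s => ENNReal.ofReal (2 * p s)) = σ ↔ ∀ᵐ s ∂σ, p s = 1 / 2 := by
  nth_rewrite 2 [← withDensity_one (μ := σ)]
  rw [withDensity_eq_iff_of_sigmaFinite (by fun_prop) (by fun_prop)]
  refine Filter.eventually_congr (Filter.Eventually.of_forall fun s => ?_)
  rw [Pi.one_apply, ENNReal.ofReal_eq_one]
  constructor <;> intro h <;> linarith

variable {Ω : Type*} {mΩ : MeasurableSpace Ω} {P : Measure Ω}

theorem map_eq_of_map_prodMk_eq_withDensity {X : Ω → α} {Y : Ω → β} (hX : Measurable X)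
    (hY : Measurable Y) {ρ : Measure α} [SFinite ρ] {σ : Measure β} [SFinite σ] {k : α × β → ℝ≥0∞}
    (hk : Measurable k) (hmass : ∀ a, ∫⁻ b, k (a, b) ∂σ = 1)
    (hXY : P.map (fun ω => (X ω, Y ω)) = (ρ.prod σ).withDensity k) : P.map X = ρ := by
  have h := congrArg (Measure.map Prod.fst) hXY
  simpa only [Measure.map_map measurable_fst (hX.prodMk hY), map_fst_prod_withDensity ρ σ hk,
    hmass, Function.comp_def, withDensity_const, one_smul] using h

theorem condDistrib_ae_eq_withDensity [StandardBorelSpace β] [Nonempty β] [IsFiniteMeasure P]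
    {X : Ω → α} {Y : Ω → β} (hX : Measurable X) (hY : Measurable Y) {ρ : Measure α} [SFinite ρ]
    {σ : Measure β} [SFinite σ] {k : α × β → ℝ≥0∞} (hk : Measurable k)
    (hmass : ∀ a, ∫⁻ b, k (a, b) ∂σ = 1)
    (hXY : P.map (fun ω => (X ω, Y ω)) = (ρ.prod σ).withDensity k) :
    ∀ᵐ a ∂P.map X, condDistrib Y X P a = σ.withDensity fun b => k (a, b) := by
  have hk' : Measurable (Function.uncurry fun a b => k (a, b)) := hk
  let κ : Kernel α β := (Kernel.const α σ).withDensity fun a b => k (a, b)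
  have hκ (a : α) : κ a = σ.withDensity fun b => k (a, b) := Kernel.withDensity_apply _ hk' a
  have : IsMarkovKernel κ :=
    ⟨fun a => ⟨by rw [hκ, withDensity_apply _ .univ, setLIntegral_univ, hmass]⟩⟩
  have hcomp : P.map (fun ω => (X ω, Y ω)) = P.map X ⊗ₘ κ := by
    rw [map_eq_of_map_prodMk_eq_withDensity hX hY hk hmass hXY, hXY,
      Measure.compProd_withDensity hk', Measure.compProd_const]
  filter_upwards [condDistrib_ae_eq_of_measure_eq_compProd X hY.aemeasurable hcomp] with a ha
  rw [ha, hκ]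

theorem exists_measurable_lift_of_leftInvOn [MeasurableEq β] {m : Measure α} {t : Set α}
    (ht : t.Nonempty) (hmt : ∀ᵐ x ∂m, x ∈ t) {Ψ : α → β} (hΨ : Measurable Ψ) {Φ : β → α}
    (hΦ : Measurable Φ) (hΦΨ : LeftInvOn Φ Ψ t) {h : β → ℝ≥0∞} (hh : Measurable h)
    {Z : Ω → β} (hZ : Measurable Z) (hZh : P.map Z = (m.map Ψ).withDensity h) :
    ∃ F : Ω → α, Measurable F ∧ (∀ ω, F ω ∈ t) ∧ (∀ᵐ ω ∂P, Z ω = Ψ (F ω)) ∧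
      P.map F = m.withDensity (h ∘ Ψ) := by
  have hΦΨ_ae : Φ ∘ Ψ =ᵐ[m.withDensity (h ∘ Ψ)] id := by
    filter_upwards [withDensity_absolutelyContinuous m _ hmt] with x hx using hΦΨ hx
  have hZΨ : P.map Z = (m.withDensity (h ∘ Ψ)).map Ψ :=
    hZh.trans (map_withDensity_comp m hΨ hh).symm
  have hΦZ : P.map (Φ ∘ Z) = m.withDensity (h ∘ Ψ) := by
    rw [← Measure.map_map hΦ hZ, hZΨ, Measure.map_map hΦ hΨ, Measure.map_congr hΦΨ_ae,
      Measure.map_id]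
  have hΨΦ : ∀ᵐ ω ∂P, Z ω = Ψ (Φ (Z ω)) := by
    have hset : MeasurableSet {z | z = Ψ (Φ z)} :=
      measurableSet_eq_fun measurable_id (hΨ.comp hΦ)
    refine ae_of_ae_map (p := fun z => z = Ψ (Φ z)) hZ.aemeasurable ?_
    rw [hZΨ, ae_map_iff hΨ.aemeasurable hset]
    filter_upwards [hΦΨ_ae] with x hx using (congrArg Ψ hx).symm
  have hmem : ∀ᵐ ω ∂P, (Φ ∘ Z) ω ∈ t := by
    refine ae_of_ae_map (hΦ.comp hZ).aemeasurable ?_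
    rw [hΦZ]
    exact withDensity_absolutelyContinuous m _ hmt
  obtain ⟨F, hF, hFt, hFZ⟩ := (hΦ.comp hZ).aemeasurable.exists_ae_eq_range_subset hmem ht
  refine ⟨F, hF, fun ω => hFt (mem_range_self ω), ?_, by rw [← hΦZ, Measure.map_congr hFZ]⟩
  filter_upwards [hΨΦ, hFZ] with ω hω hFω
  rw [← hFω]
  exact hω

end Measures

noncomputable section PolarCoordinates

open Metric Module
open scoped ENNReal

variable {F : Type*} [NormedAddCommGroup F]

theorem ae_mem_prod_sphere [MeasurableSpace F] {ρ : Measure ℝ} (hρ : ∀ᵐ r ∂ρ, 0 < r)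
    {σ : Measure F} (hσ : ∀ᵐ s ∂σ, ‖s‖ = 1) :
    ∀ᵐ p ∂ρ.prod σ, p ∈ Ioi 0 ×ˢ sphere 0 1 := by
  filter_upwards [Measure.quasiMeasurePreserving_fst.ae hρ,
    Measure.quasiMeasurePreserving_snd.ae hσ] with p hr hs
  exact ⟨hr, mem_sphere_zero_iff_norm.2 hs⟩

variable [NormedSpace ℝ F]

/-- Polar coordinates: the radius and the direction of a vector (`(0, 0)` at the origin). -/
def radiusDirection (y : F) : ℝ × F := (‖y‖, ‖y‖⁻¹ • y)

/-- The radial factor `r ^ n dr` on `(0, ∞)` of Lebesgue measure in dimension `n + 1`. -/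
def radialMeasure (n : ℕ) : Measure ℝ :=
  (volume.restrict (Ioi 0)).withDensity fun r => ENNReal.ofReal (r ^ n)

instance (n : ℕ) : SigmaFinite (radialMeasure n) :=
  SigmaFinite.withDensity_ofReal _

theorem lintegral_radialMeasure (n : ℕ) {f : ℝ → ℝ≥0∞} (hf : Measurable f) :
    ∫⁻ r, f r ∂radialMeasure n = ∫⁻ r in Ioi 0, ENNReal.ofReal (r ^ n) * f r :=
  lintegral_withDensity_eq_lintegral_mul _ (by fun_prop) hf

theorem ae_radialMeasure_pos (n : ℕ) : ∀ᵐ r ∂radialMeasure n, 0 < r :=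
  withDensity_absolutelyContinuous _ _ (ae_restrict_mem measurableSet_Ioi)

theorem radialMeasure_ne_zero (n : ℕ) : radialMeasure n ≠ 0 := by
  rw [radialMeasure, Ne, withDensity_eq_zero_iff (by fun_prop)]
  intro h
  have hfalse : ∀ᵐ _ ∂volume.restrict (Ioi (0 : ℝ)), False := by
    filter_upwards [h, ae_restrict_mem measurableSet_Ioi] with r hr hr0
    exact (ENNReal.ofReal_pos.2 (pow_pos hr0 n)).ne' hr
  simp only [Filter.eventually_false_iff_eq_bot, ae_eq_bot, Measure.restrict_eq_zero,
    Real.volume_Ioi, ENNReal.top_ne_zero] at hfalse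

theorem map_val_volumeIoiPow (n : ℕ) :
    (Measure.volumeIoiPow n).map (Subtype.val : Ioi (0 : ℝ) → ℝ) = radialMeasure n := by
  rw [radialMeasure, ← map_comap_subtype_coe measurableSet_Ioi (volume : Measure ℝ)]
  exact map_withDensity_comp (g := fun r => ENNReal.ofReal (r ^ n)) _ measurable_subtype_coe
    (by fun_prop)

theorem leftInvOn_radiusDirection_smul :
    LeftInvOn radiusDirection (fun p : ℝ × F => p.1 • p.2) (Ioi 0 ×ˢ sphere 0 1) := by
  rintro ⟨r, s⟩ ⟨hr : 0 < r, hs⟩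
  rw [mem_sphere_zero_iff_norm] at hs
  have hnorm : ‖r • s‖ = r := by rw [norm_smul, hs, mul_one, Real.norm_of_nonneg hr.le]
  simp only [radiusDirection, hnorm, inv_smul_smul₀ hr.ne']

variable [MeasurableSpace F] [BorelSpace F]

theorem measurable_radiusDirection : Measurable (radiusDirection : F → ℝ × F) :=
  measurable_norm.prodMk (measurable_norm.inv.smul measurable_id)

/-- The surface measure of the unit sphere, as a measure on the ambient space. -/
def surfaceMeasure (μ : Measure F) : Measure F :=
  μ.toSphere.map (Subtype.val : sphere (0 : F) 1 → F)

theorem ae_norm_surfaceMeasure (μ : Measure F) : ∀ᵐ s ∂surfaceMeasure μ, ‖s‖ = 1 := by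
  have hset : MeasurableSet {s : F | ‖s‖ = 1} := measurableSet_eq_fun (by fun_prop) (by fun_prop)
  rw [surfaceMeasure, ae_map_iff measurable_subtype_coe.aemeasurable hset]
  exact .of_forall norm_eq_of_mem_sphere

variable [FiniteDimensional ℝ F]

theorem map_radiusDirection_map_smul {ρ : Measure ℝ} (hρ : ∀ᵐ r ∂ρ, 0 < r)
    {σ : Measure F} (hσ : ∀ᵐ s ∂σ, ‖s‖ = 1) :
    ((ρ.prod σ).map fun p => p.1 • p.2).map radiusDirection = ρ.prod σ := by
  have hid : radiusDirection ∘ (fun p : ℝ × F => p.1 • p.2) =ᵐ[ρ.prod σ] id := by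
    filter_upwards [ae_mem_prod_sphere hρ hσ] with p hp using leftInvOn_radiusDirection_smul hp
  rw [Measure.map_map measurable_radiusDirection (by fun_prop), Measure.map_congr hid,
    Measure.map_id]

variable (μ : Measure F) [μ.IsAddHaarMeasure]

instance : SFinite (surfaceMeasure μ) := by
  unfold surfaceMeasure
  infer_instance

theorem addHaar_eq_map_smul [Nontrivial F] :
    μ = ((radialMeasure (finrank ℝ F - 1)).prod (surfaceMeasure μ)).map fun p => p.1 • p.2 := by
  have hpolar := (Measure.measurePreserving_homeomorphUnitSphereProd μ).symm
    (homeomorphUnitSphereProd F).toMeasurableEquiv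
  have hsubtype : (μ.comap (Subtype.val : ({0}ᶜ : Set F) → F)).map Subtype.val = μ := by
    rw [map_comap_subtype_coe (measurableSet_singleton _).compl]
    exact Measure.restrict_eq_self_of_ae_mem (Measure.ae_ne μ 0)
  rw [← map_val_volumeIoiPow, surfaceMeasure,
    Measure.map_prod_map _ _ measurable_subtype_coe measurable_subtype_coe, ← Measure.prod_swap,
    Measure.map_map (by fun_prop) (by fun_prop), Measure.map_map (by fun_prop) (by fun_prop)]
  conv_lhs => rw [← hsubtype, ← hpolar.map_eq]
  rw [Measure.map_map measurable_subtype_coe (MeasurableEquiv.measurable _)]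
  rfl

theorem eq_surfaceMeasure_of_map_smul_eq [Nontrivial F] {σ : Measure F} [SFinite σ]
    (hσ : ∀ᵐ s ∂σ, ‖s‖ = 1)
    (h : ((radialMeasure (finrank ℝ F - 1)).prod σ).map (fun p => p.1 • p.2) = μ) :
    σ = surfaceMeasure μ := by
  have hρ := ae_radialMeasure_pos (finrank ℝ F - 1)
  refine eq_of_prod_eq_prod_left (radialMeasure_ne_zero (finrank ℝ F - 1)) ?_
  rw [← map_radiusDirection_map_smul hρ hσ, h,
    ← map_radiusDirection_map_smul hρ (ae_norm_surfaceMeasure μ), ← addHaar_eq_map_smul]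

theorem map_surfaceMeasure [Nontrivial F] (g : F ≃ₗᵢ[ℝ] F) (hg : MeasurePreserving g μ μ) :
    (surfaceMeasure μ).map g = surfaceMeasure μ := by
  have hgm : Measurable g := g.continuous.measurable
  refine eq_surfaceMeasure_of_map_smul_eq μ ?_ ?_
  · have hset : MeasurableSet {s : F | ‖s‖ = 1} := measurableSet_eq_fun (by fun_prop) (by fun_prop)
    rw [ae_map_iff hgm.aemeasurable hset]
    simpa only [g.norm_map] using ae_norm_surfaceMeasure μ
  · conv_rhs => rw [← hg.map_eq, addHaar_eq_map_smul μ]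
    conv_lhs => rw [← Measure.map_id (μ := radialMeasure (finrank ℝ F - 1)),
      Measure.map_prod_map _ _ measurable_id hgm]
    rw [Measure.map_map (by fun_prop) (measurable_id.prodMap hgm),
      Measure.map_map hgm (by fun_prop)]
    congr 1
    ext p
    simp

theorem withDensity_norm_eq_map_smul [Nontrivial F] {φ : ℝ → ℝ≥0∞} (hφ : Measurable φ) :
    μ.withDensity (fun y => φ ‖y‖) =
      (((radialMeasure (finrank ℝ F - 1)).withDensity φ).prod (surfaceMeasure μ)).map
        fun p => p.1 • p.2 := by
  have hρ := ae_radialMeasure_pos (finrank ℝ F - 1)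
  rw [prod_withDensity_left hφ]
  conv_lhs => rw [addHaar_eq_map_smul μ]
  rw [← map_withDensity_comp _ (by fun_prop) (by fun_prop)]
  refine congrArg (Measure.map _) (withDensity_congr_ae ?_)
  filter_upwards [ae_mem_prod_sphere hρ (ae_norm_surfaceMeasure μ)] with p hp
  exact congrArg (fun q => φ q.1) (leftInvOn_radiusDirection_smul hp)

end PolarCoordinates

noncomputable section SphericalCoordinates

open scoped ENNReal

theorem volume_preserving_finCons (n : ℕ) :
    MeasurePreserving fun p : ℝ × (Fin n → ℝ) => (Fin.cons p.1 p.2 : Fin (n + 1) → ℝ) := by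
  convert (volume_preserving_piFinSuccAbove (fun _ : Fin (n + 1) => ℝ) 0).symm using 1
  funext p
  exact (Fin.insertNth_zero' p.1 p.2).symm

theorem lintegral_fin_succ {n : ℕ} {f : (Fin (n + 1) → ℝ) → ℝ≥0∞} (hf : Measurable f) :
    ∫⁻ x, f x = ∫⁻ a : ℝ, ∫⁻ y : Fin n → ℝ, f (Fin.cons a y) := by
  have hcons := volume_preserving_finCons n
  rw [← hcons.lintegral_comp hf]
  exact lintegral_prod _ (hf.comp hcons.measurable).aemeasurable

theorem lintegral_polar {g : ℝ × ℝ → ℝ≥0∞} (hg : Measurable g) :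
    ∫⁻ p, g p = ∫⁻ r in Ioi 0, ENNReal.ofReal r *
      ∫⁻ φ in Ioo (-Real.pi) Real.pi, g (r * Real.cos φ, r * Real.sin φ) := by
  have hpolar : Measurable fun p : ℝ × ℝ =>
      ENNReal.ofReal p.1 * g (p.1 * Real.cos p.2, p.1 * Real.sin p.2) := by fun_prop
  rw [← lintegral_comp_polarCoord_symm, polarCoord_target, Measure.volume_eq_prod,
    ← Measure.prod_restrict]
  refine (lintegral_prod _ hpolar.aemeasurable).trans (lintegral_congr fun r => ?_)
  exact lintegral_const_mul' _ _ ENNReal.ofReal_ne_top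

theorem sin_pos_and_mem_Ioo_iff {φ : ℝ} :
    0 < Real.sin φ ∧ φ ∈ Ioo (-Real.pi) Real.pi ↔ φ ∈ Ioo 0 Real.pi := by
  refine ⟨fun ⟨hsin, hφ⟩ => ⟨not_le.1 fun h => ?_, hφ.2⟩, fun hφ =>
    ⟨Real.sin_pos_of_mem_Ioo hφ, by linarith [Real.pi_pos, hφ.1], hφ.2⟩⟩
  exact hsin.not_ge (Real.sin_nonpos_of_nonpos_of_neg_pi_le h hφ.1.le)

theorem lintegral_polar_upperHalfPlane {g : ℝ × ℝ → ℝ≥0∞} (hg : Measurable g) :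
    ∫⁻ x, ∫⁻ y in Ioi 0, g (x, y) = ∫⁻ r in Ioi 0, ENNReal.ofReal r *
      ∫⁻ φ in Ico 0 Real.pi, g (r * Real.cos φ, r * Real.sin φ) := by
  let H : Set (ℝ × ℝ) := {p | 0 < p.2}
  have hH : MeasurableSet H := measurableSet_lt measurable_const measurable_snd
  have hhalf : ∫⁻ x, ∫⁻ y in Ioi 0, g (x, y) = ∫⁻ p, H.indicator g p := by
    rw [Measure.volume_eq_prod, lintegral_prod _ (hg.indicator hH).aemeasurable]
    refine lintegral_congr fun x => ?_
    rw [← lintegral_indicator measurableSet_Ioi]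
    rfl
  rw [hhalf, lintegral_polar (hg.indicator hH)]
  refine setLIntegral_congr_fun measurableSet_Ioi fun r (hr : 0 < r) => ?_
  congr 1
  have hsin : MeasurableSet {φ | 0 < Real.sin φ} :=
    measurableSet_lt measurable_const Real.measurable_sin
  have hset : {φ | 0 < Real.sin φ} ∩ Ioo (-Real.pi) Real.pi = Ioo 0 Real.pi :=
    ext fun φ => sin_pos_and_mem_Ioo_iff
  have hind (φ : ℝ) : H.indicator g (r * Real.cos φ, r * Real.sin φ) =
      {φ | 0 < Real.sin φ}.indicator (fun φ => g (r * Real.cos φ, r * Real.sin φ)) φ := by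
    simp only [H, indicator, mem_ofPred_eq, mul_pos_iff_of_pos_left hr]
  simp only [hind]
  rw [setLIntegral_indicator hsin, hset, setLIntegral_congr Ioo_ae_eq_Ico]

theorem setLIntegral_Ioo_neg_pi_pi {u : ℝ → ℝ≥0∞} (hu : u.Periodic (2 * Real.pi)) :
    ∫⁻ φ in Ioo (-Real.pi) Real.pi, u φ = ∫⁻ φ in Ico 0 (2 * Real.pi), u φ := by
  have h := (isAddFundamentalDomain_Ioc Real.two_pi_pos (-Real.pi)).setLIntegral_eq
    (isAddFundamentalDomain_Ioc Real.two_pi_pos 0) u fun ⟨_, ha⟩ φ => by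
      obtain ⟨k, rfl⟩ := AddSubgroup.mem_zmultiples_iff.1 ha
      rw [AddSubgroup.mk_vadd, vadd_eq_add, add_comm]
      exact hu.zsmul k φ
  rwa [show -Real.pi + 2 * Real.pi = Real.pi by ring, zero_add,
    setLIntegral_congr Ioo_ae_eq_Ioc.symm, setLIntegral_congr Ico_ae_eq_Ioc.symm] at h

/-- The angular part of Lebesgue measure on `ℝ^d` in spherical coordinates. -/
def angleMeasure (d : ℕ) : Measure (Fin (d - 1) → ℝ) :=
  (volume.restrict (angleBox d)).withDensity fun θ => ENNReal.ofReal (angleJacobian θ)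

instance (d : ℕ) : SigmaFinite (angleMeasure d) :=
  SigmaFinite.withDensity_ofReal _

theorem measurableSet_angleBox (d : ℕ) : MeasurableSet (angleBox d) := by
  have : angleBox d = Set.pi univ fun k : Fin (d - 1) =>
      Ico 0 (if k.val + 1 = d - 1 then 2 * Real.pi else Real.pi) := by
    ext; simp [angleBox]
  rw [this]
  exact MeasurableSet.univ_pi fun _ => measurableSet_Ico

theorem measurable_sphPoint {d : ℕ} : Measurable (sphPoint (d := d)) := by
  unfold sphPoint
  refine (PiLp.volume_preserving_toLp (Fin d)).measurable.comp (measurable_pi_lambda _ fun j => ?_)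
  refine Measurable.mul (Finset.measurable_prod _ fun k _ => ?_) ?_
  · split_ifs <;> fun_prop
  · split_ifs <;> fun_prop

theorem measurable_angleJacobian {d : ℕ} : Measurable (angleJacobian (d := d)) := by
  unfold angleJacobian
  fun_prop

theorem angleJacobian_nonneg {d : ℕ} {θ : Fin (d - 1) → ℝ} (hθ : θ ∈ angleBox d) :
    0 ≤ angleJacobian θ := by
  refine Finset.prod_nonneg fun k _ => ?_
  have hk := hθ k
  by_cases h : k.val + 1 = d - 1
  · have : d - 2 - k.val = 0 := by omega
    simp [this]
  · rw [if_neg h] at hk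
    exact pow_nonneg (Real.sin_nonneg_of_nonneg_of_le_pi hk.1 hk.2.le) _

theorem sphPoint_cons {n : ℕ} (φ : ℝ) (θ : Fin (n + 1) → ℝ) :
    (sphPoint (d := n + 3) (Fin.cons φ θ : Fin (n + 2) → ℝ)).ofLp =
      Fin.cons (Real.cos φ) (Real.sin φ • (sphPoint (d := n + 2) θ).ofLp) := by
  funext j
  refine Fin.cases ?_ (fun j => ?_) j
  · simp only [sphPoint]
    rw [dif_pos (by simp), Finset.prod_eq_one fun k _ => if_neg (by simp), one_mul]
    rfl
  · simp only [sphPoint, Fin.cons_succ, Pi.smul_apply, smul_eq_mul]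
    rw [← mul_assoc]
    congr 1
    · refine (Fin.prod_univ_succ (n := n + 1) _).trans ?_
      simp
    · by_cases h : j.val < n + 1
      · rw [dif_pos (by simp; omega), dif_pos (by simpa using h)]
        exact congrArg Real.cos (Fin.cons_succ (α := fun _ => ℝ) φ θ ⟨j.val, h⟩)
      · rw [dif_neg (by simp; omega), dif_neg (by simpa using h)]

theorem angleJacobian_cons {n : ℕ} (φ : ℝ) (θ : Fin (n + 1) → ℝ) :
    angleJacobian (d := n + 3) (Fin.cons φ θ : Fin (n + 2) → ℝ) =
      Real.sin φ ^ (n + 1) * angleJacobian (d := n + 2) θ := by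
  refine (Fin.prod_univ_succ (n := n + 1) _).trans ?_
  simp only [angleJacobian, Fin.cons_zero, Fin.cons_succ, Fin.val_zero, Fin.val_succ]
  congr 1
  refine Finset.prod_congr rfl fun k _ => ?_
  congr 1
  omega

theorem cons_mem_angleBox {n : ℕ} (φ : ℝ) (θ : Fin (n + 1) → ℝ) :
    (Fin.cons φ θ : Fin (n + 2) → ℝ) ∈ angleBox (n + 3) ↔
      φ ∈ Ico 0 Real.pi ∧ θ ∈ angleBox (n + 2) := by
  refine (Fin.forall_fin_succ (n := n + 1)).trans (and_congr ?_ ?_)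
  · simp
  · refine forall_congr' fun k => ?_
    simp

theorem sphPoint_two (θ : Fin 1 → ℝ) :
    (sphPoint (d := 2) θ).ofLp = ![Real.cos (θ 0), Real.sin (θ 0)] := by
  funext j
  fin_cases j
  · simp [sphPoint]
  · simp [sphPoint]

theorem angleJacobian_two (θ : Fin 1 → ℝ) : angleJacobian (d := 2) θ = 1 := by
  simp [angleJacobian]

theorem lintegral_angleMeasure {d : ℕ} {f : (Fin (d - 1) → ℝ) → ℝ≥0∞} (hf : Measurable f) :
    ∫⁻ θ, f θ ∂angleMeasure d = ∫⁻ θ in angleBox d, ENNReal.ofReal (angleJacobian θ) * f θ :=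
  lintegral_withDensity_eq_lintegral_mul _ measurable_angleJacobian.ennreal_ofReal hf

theorem lintegral_angleMeasure_two {f : (Fin 1 → ℝ) → ℝ≥0∞} (hf : Measurable f) :
    ∫⁻ θ, f θ ∂angleMeasure 2 = ∫⁻ φ in Ico 0 (2 * Real.pi), f fun _ => φ := by
  have hconst := (volume_preserving_funUnique (Fin 1) ℝ).symm
  have hbox : (MeasurableEquiv.funUnique (Fin 1) ℝ).symm ⁻¹' angleBox 2 =
      Ico 0 (2 * Real.pi) := ext fun φ => Fin.forall_fin_one
  refine (lintegral_angleMeasure (d := 2) hf).trans ?_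
  simp only [angleJacobian_two, ENNReal.ofReal_one, one_mul]
  rw [← hbox]
  exact (hconst.setLIntegral_comp_preimage_emb (MeasurableEquiv.measurableEmbedding _) f _).symm

theorem lintegral_angleMeasure_succ {n : ℕ} {f : (Fin (n + 2) → ℝ) → ℝ≥0∞} (hf : Measurable f) :
    ∫⁻ θ, f θ ∂angleMeasure (n + 3) = ∫⁻ φ in Ico 0 Real.pi, ENNReal.ofReal (Real.sin φ ^ (n + 1)) *
      ∫⁻ θ, f (Fin.cons φ θ) ∂angleMeasure (n + 2) := by
  have hbox := measurableSet_angleBox (n + 3)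
  have hmeas : Measurable fun θ => ENNReal.ofReal (angleJacobian (d := n + 3) θ) * f θ :=
    measurable_angleJacobian.ennreal_ofReal.mul hf
  refine (lintegral_angleMeasure (d := n + 3) hf).trans ?_
  rw [← lintegral_indicator hbox, ← lintegral_indicator measurableSet_Ico]
  refine (lintegral_fin_succ (hmeas.indicator hbox)).trans (lintegral_congr fun φ => ?_)
  by_cases hφ : φ ∈ Ico 0 Real.pi
  · have hsin : 0 ≤ Real.sin φ ^ (n + 1) :=
      pow_nonneg (Real.sin_nonneg_of_nonneg_of_le_pi hφ.1 hφ.2.le) _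
    have hfφ : Measurable fun θ : Fin (n + 1) → ℝ => f (Fin.cons φ θ) :=
      hf.comp ((volume_preserving_finCons _).measurable.comp measurable_prodMk_left)
    rw [indicator_of_mem hφ, lintegral_angleMeasure (d := n + 2) hfφ,
      ← lintegral_const_mul' _ _ ENNReal.ofReal_ne_top,
      ← lintegral_indicator (measurableSet_angleBox (n + 2))]
    refine lintegral_congr fun θ => ?_
    simp only [indicator, angleJacobian_cons, ENNReal.ofReal_mul hsin, mul_assoc]
    classical exact if_congr ((cons_mem_angleBox φ θ).trans (and_iff_right hφ)) rfl rfl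
  · rw [indicator_of_notMem hφ]
    refine (lintegral_congr fun θ => ?_).trans lintegral_zero
    exact indicator_of_notMem (fun h => hφ ((cons_mem_angleBox φ θ).1 h).1) _

theorem measurable_ofLp_sphPoint {d : ℕ} : Measurable fun θ => (sphPoint (d := d) θ).ofLp :=
  (PiLp.volume_preserving_ofLp (Fin d)).measurable.comp measurable_sphPoint

theorem smul_sphPoint_cons {n : ℕ} (r φ : ℝ) (θ : Fin (n + 1) → ℝ) :
    r • (sphPoint (d := n + 3) (Fin.cons φ θ : Fin (n + 2) → ℝ)).ofLp =
      Fin.cons (r * Real.cos φ) ((r * Real.sin φ) • (sphPoint (d := n + 2) θ).ofLp) := by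
  rw [sphPoint_cons]
  funext j
  refine Fin.cases ?_ (fun j => ?_) j
  · simp
  · simp [mul_assoc]

theorem lintegral_spherical_two {f : (Fin 2 → ℝ) → ℝ≥0∞} (hf : Measurable f) :
    ∫⁻ x, f x = ∫⁻ r in Ioi 0, ENNReal.ofReal r *
      ∫⁻ θ, f (r • (sphPoint θ).ofLp) ∂angleMeasure 2 := by
  have hpair := (volume_preserving_finTwoArrow ℝ).symm
  rw [← hpair.lintegral_comp hf]
  refine (lintegral_polar (hf.comp hpair.measurable)).trans (lintegral_congr fun r => ?_)
  have hfr : Measurable fun θ => f (r • (sphPoint (d := 2) θ).ofLp) :=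
    hf.comp (measurable_ofLp_sphPoint.const_smul r)
  rw [lintegral_angleMeasure_two hfr,
    setLIntegral_Ioo_neg_pi_pi fun φ => by rw [Real.cos_add_two_pi, Real.sin_add_two_pi]]
  simp only [sphPoint_two]
  simp [MeasurableEquiv.finTwoArrow, MeasurableEquiv.piFinTwo]

theorem lintegral_smul_sphPoint_succ {n : ℕ} {f : (Fin (n + 3) → ℝ) → ℝ≥0∞} (hf : Measurable f)
    (r : ℝ) :
    ∫⁻ θ, f (r • (sphPoint θ).ofLp) ∂angleMeasure (n + 3) =
      ∫⁻ φ in Ico 0 Real.pi, ENNReal.ofReal (Real.sin φ ^ (n + 1)) *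
        ∫⁻ θ, f (Fin.cons (r * Real.cos φ) ((r * Real.sin φ) • (sphPoint θ).ofLp))
          ∂angleMeasure (n + 2) := by
  have hfr : Measurable fun θ => f (r • (sphPoint (d := n + 3) θ).ofLp) :=
    hf.comp (measurable_ofLp_sphPoint.const_smul r)
  rw [lintegral_angleMeasure_succ hfr]
  simp only [← smul_sphPoint_cons]

theorem lintegral_spherical (n : ℕ) {f : (Fin (n + 2) → ℝ) → ℝ≥0∞} (hf : Measurable f) :
    ∫⁻ x, f x = ∫⁻ r in Ioi 0, ENNReal.ofReal (r ^ (n + 1)) *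
      ∫⁻ θ, f (r • (sphPoint θ).ofLp) ∂angleMeasure (n + 2) := by
  induction n with
  | zero => simpa only [zero_add, pow_one] using lintegral_spherical_two hf
  | succ n ih =>
    let H (p : ℝ × ℝ) : ℝ≥0∞ :=
      ∫⁻ θ, f (Fin.cons p.1 (p.2 • (sphPoint θ).ofLp)) ∂angleMeasure (n + 2)
    have hH : Measurable H := by
      refine Measurable.lintegral_prod_right' (ν := angleMeasure (n + 2))
        (f := fun q : (ℝ × ℝ) × (Fin (n + 2 - 1) → ℝ) =>
          f (Fin.cons q.1.1 (q.1.2 • (sphPoint q.2).ofLp))) (hf.comp ?_)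
      exact (volume_preserving_finCons _).measurable.comp (measurable_fst.fst.prodMk
        (measurable_fst.snd.smul (measurable_ofLp_sphPoint.comp measurable_snd)))
    calc ∫⁻ x, f x
        = ∫⁻ a : ℝ, ∫⁻ y : Fin (n + 2) → ℝ, f (Fin.cons a y) := lintegral_fin_succ hf
      _ = ∫⁻ a : ℝ, ∫⁻ ρ in Ioi 0, ENNReal.ofReal (ρ ^ (n + 1)) * H (a, ρ) :=
          lintegral_congr fun a =>
            ih (hf.comp ((volume_preserving_finCons _).measurable.comp measurable_prodMk_left))
      _ = ∫⁻ r in Ioi 0, ENNReal.ofReal r * ∫⁻ φ in Ico 0 Real.pi,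
            ENNReal.ofReal ((r * Real.sin φ) ^ (n + 1)) * H (r * Real.cos φ, r * Real.sin φ) :=
          lintegral_polar_upperHalfPlane
            (g := fun p => ENNReal.ofReal (p.2 ^ (n + 1)) * H p) (by fun_prop)
      _ = _ := by
          refine setLIntegral_congr_fun measurableSet_Ioi fun r (hr : 0 < r) => ?_
          have hrn : 0 ≤ r ^ (n + 1) := pow_nonneg hr.le _
          simp only [lintegral_smul_sphPoint_succ hf, mul_pow, ENNReal.ofReal_mul hrn, mul_assoc,
            pow_succ r (n + 1)]
          rw [lintegral_const_mul' _ _ ENNReal.ofReal_ne_top]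
          ring

theorem norm_sphPoint (n : ℕ) (θ : Fin (n + 1) → ℝ) : ‖sphPoint (d := n + 2) θ‖ = 1 := by
  rw [EuclideanSpace.norm_eq, Real.sqrt_eq_one]
  simp only [Real.norm_eq_abs, sq_abs]
  induction n with
  | zero => simp [sphPoint_two]
  | succ n ih =>
    have h := sphPoint_cons (θ 0) (Fin.tail θ)
    rw [Fin.cons_self_tail] at h
    rw [h, Fin.sum_univ_succ]
    simp only [Fin.cons_zero, Fin.cons_succ, Pi.smul_apply, smul_eq_mul, mul_pow,
      ← Finset.mul_sum, ih, mul_one, Real.cos_sq_add_sin_sq]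

theorem map_smul_radialMeasure_prod_map_sphPoint (n : ℕ) :
    ((radialMeasure (n + 1)).prod ((angleMeasure (n + 2)).map sphPoint)).map (fun p => p.1 • p.2) =
      (volume : Measure (E (n + 2))) := by
  have htoLp := PiLp.volume_preserving_toLp (Fin (n + 2))
  refine Measure.ext_of_lintegral _ fun f hf => ?_
  have hfsmul : Measurable fun p : ℝ × E (n + 2) => f (p.1 • p.2) := by fun_prop
  rw [lintegral_map hf (by fun_prop), lintegral_prod _ hfsmul.aemeasurable,
    lintegral_radialMeasure _ hfsmul.lintegral_prod_right', ← htoLp.lintegral_comp hf]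
  refine Eq.trans (lintegral_congr fun r => ?_)
    (lintegral_spherical n (hf.comp htoLp.measurable)).symm
  have hfr : Measurable fun y => f (r • y) := hf.comp (measurable_const_smul r)
  rw [lintegral_map hfr measurable_sphPoint]
  rfl

theorem surfaceMeasure_eq_map_sphPoint {d : ℕ} (hd : 2 ≤ d) :
    surfaceMeasure (volume : Measure (E d)) = (angleMeasure d).map sphPoint := by
  obtain ⟨n, rfl⟩ := Nat.exists_eq_add_of_le' hd
  have hset : MeasurableSet {s : E (n + 2) | ‖s‖ = 1} :=
    measurableSet_eq_fun (by fun_prop) (by fun_prop)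
  refine (eq_surfaceMeasure_of_map_smul_eq volume ?_ ?_).symm
  · rw [ae_map_iff measurable_sphPoint.aemeasurable hset]
    exact .of_forall (norm_sphPoint n)
  · rw [finrank_euclideanSpace_fin]
    exact map_smul_radialMeasure_prod_map_sphPoint n

end SphericalCoordinates

section UniformSphere

open scoped ENNReal

variable {d : ℕ}

theorem toSphere_univ_eq (hd : 1 ≤ d) :
    (volume : Measure (E d)).toSphere univ =
      ENNReal.ofReal (2 * Real.pi ^ ((d : ℝ) / 2) / Real.Gamma (d / 2)) := by
  have : Nonempty (Fin d) := ⟨⟨0, hd⟩⟩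
  have hd' : (0 : ℝ) < d / 2 := by positivity
  have hΓ := (Real.Gamma_pos_of_pos hd').ne'
  rw [Measure.toSphere_apply_univ, EuclideanSpace.volume_ball, finrank_euclideanSpace,
    Fintype.card_fin, ENNReal.ofReal_one, one_pow, one_mul, ← ENNReal.ofReal_natCast,
    ← ENNReal.ofReal_mul d.cast_nonneg, Real.Gamma_add_one hd'.ne', Real.sqrt_eq_rpow,
    ← Real.rpow_natCast, ← Real.rpow_mul Real.pi_pos.le, one_div_mul_eq_div]
  congr 1
  field_simp

theorem toSphere_univ_ne_zero (hd : 1 ≤ d) : (volume : Measure (E d)).toSphere univ ≠ 0 := by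
  have : Nonempty (Fin d) := ⟨⟨0, hd⟩⟩
  exact Measure.measure_univ_ne_zero.2 (Measure.toSphere_ne_zero volume)

theorem unifSphere_eq_smul (d : ℕ) :
    unifSphere d =
      ((volume : Measure (E d)).toSphere univ)⁻¹ • surfaceMeasure (volume : Measure (E d)) := by
  rw [unifSphere, surfaceMeasure, Measure.map_smul]

theorem surfaceMeasure_eq_smul (hd : 1 ≤ d) :
    surfaceMeasure (volume : Measure (E d)) =
      (volume : Measure (E d)).toSphere univ • unifSphere d := by
  rw [unifSphere_eq_smul, smul_smul, ENNReal.mul_inv_cancel (toSphere_univ_ne_zero hd)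
    (measure_ne_top _ _), one_smul]

instance (d : ℕ) : SFinite (unifSphere d) := by
  rw [unifSphere_eq_smul]
  infer_instance

theorem isProbabilityMeasure_unifSphere (hd : 1 ≤ d) : IsProbabilityMeasure (unifSphere d) := by
  constructor
  rw [unifSphere, Measure.map_apply measurable_subtype_coe .univ, preimage_univ,
    Measure.smul_apply, smul_eq_mul,
    ENNReal.inv_mul_cancel (toSphere_univ_ne_zero hd) (measure_ne_top _ _)]

theorem ae_norm_unifSphere (d : ℕ) : ∀ᵐ s ∂unifSphere d, ‖s‖ = 1 := by
  rw [unifSphere_eq_smul]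
  exact Measure.ae_smul_measure (ae_norm_surfaceMeasure volume) _

theorem isNegInvariant_unifSphere (hd : 1 ≤ d) : (unifSphere d).IsNegInvariant := by
  have : Nonempty (Fin d) := ⟨⟨0, hd⟩⟩
  constructor
  rw [unifSphere_eq_smul, Measure.neg, Measure.map_smul]
  congr 1
  exact map_surfaceMeasure volume (.neg ℝ) (Measure.measurePreserving_neg _)

theorem hasSphericalDensity_withDensity (hd : 2 ≤ d) {p : E d → ℝ} (hp : Measurable p) :
    HasSphericalDensity ((unifSphere d).withDensity fun s => ENNReal.ofReal (2 * p s))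
      (fun θ => Real.Gamma (d / 2) / Real.pi ^ ((d : ℝ) / 2) * angleJacobian θ *
        p (sphPoint θ)) := by
  have : (0 : ℝ) < d / 2 := by positivity
  have hp2 : Measurable fun s => ENNReal.ofReal (2 * p s) := by fun_prop
  have hp2s : Measurable fun θ => ENNReal.ofReal (2 * p (sphPoint (d := d) θ)) :=
    hp2.comp measurable_sphPoint
  rw [HasSphericalDensity, unifSphere_eq_smul, surfaceMeasure_eq_map_sphPoint hd,
    withDensity_smul_measure, ← map_withDensity_comp _ measurable_sphPoint hp2, ← Measure.map_smul,
    angleMeasure, ← withDensity_mul _ measurable_angleJacobian.ennreal_ofReal hp2s,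
    toSphere_univ_eq (by lia), ← ENNReal.ofReal_inv_of_pos (by positivity), inv_div,
    ← withDensity_smul' _ _ ENNReal.ofReal_ne_top]
  refine congrArg (Measure.map _) (withDensity_congr_ae ?_)
  filter_upwards [ae_restrict_mem (measurableSet_angleBox d)] with θ hθ
  have hJ := angleJacobian_nonneg hθ
  rw [Pi.smul_apply, Pi.mul_apply, smul_eq_mul, ← ENNReal.ofReal_mul hJ,
    ← ENNReal.ofReal_mul (by positivity)]
  congr 1
  field_simp

end UniformSphere

section MatrixAction

variable {d : ℕ}

theorem act_eq_toEuclideanLin (A : Matrix (Fin d) (Fin d) ℝ) (x : E d) :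
    act A x = Matrix.toEuclideanLin A x := rfl

theorem measurable_act (A : Matrix (Fin d) (Fin d) ℝ) : Measurable (act A) :=
  (LinearMap.continuous_of_finiteDimensional (Matrix.toEuclideanLin A)).measurable

theorem act_act (A B : Matrix (Fin d) (Fin d) ℝ) (x : E d) : act A (act B x) = act (A * B) x := by
  simp [act, Matrix.mulVec_mulVec]

theorem act_one (x : E d) : act (1 : Matrix (Fin d) (Fin d) ℝ) x = x := by
  simp [act]

theorem act_smul (A : Matrix (Fin d) (Fin d) ℝ) (r : ℝ) (x : E d) :
    act A (r • x) = r • act A x := by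
  simp only [act_eq_toEuclideanLin, map_smul]

theorem act_neg (A : Matrix (Fin d) (Fin d) ℝ) (x : E d) : act A (-x) = -act A x := by
  simp only [act_eq_toEuclideanLin, map_neg]

theorem act_inv_act {A : Matrix (Fin d) (Fin d) ℝ} (hA : IsUnit A.det) (x : E d) :
    act A⁻¹ (act A x) = x := by
  rw [act_act, Matrix.nonsing_inv_mul _ hA, act_one]

theorem quad_transpose_mul_self (A : Matrix (Fin d) (Fin d) ℝ) (x : E d) :
    quad (Aᵀ * A) x = ‖act A x‖ ^ 2 := by
  rw [EuclideanSpace.real_norm_sq_eq, quad, ← Matrix.mulVec_mulVec, Matrix.dotProduct_mulVec,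
    Matrix.vecMul_transpose]
  simp only [act, dotProduct, sq]

theorem quad_inv_transpose_mul_self (A : Matrix (Fin d) (Fin d) ℝ) (x : E d) :
    quad (Aᵀ * A)⁻¹ x = ‖act Aᵀ⁻¹ x‖ ^ 2 := by
  rw [← quad_transpose_mul_self, Matrix.mul_inv_rev, Matrix.transpose_nonsing_inv,
    Matrix.transpose_transpose]

theorem isUnit_det_of_transpose_mul_self {A : Matrix (Fin d) (Fin d) ℝ}
    (hA : IsUnit (Aᵀ * A).det) : IsUnit A.det := by
  rw [Matrix.det_mul] at hA
  exact isUnit_of_mul_isUnit_right hA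

theorem volume_eq_smul_map_affine {A : Matrix (Fin d) (Fin d) ℝ} (hA : IsUnit A.det) (ξ : E d) :
    (volume : Measure (E d)) =
      ENNReal.ofReal |A.det| • volume.map fun y : E d => ξ + act A y := by
  have hdet : LinearMap.det (Matrix.toEuclideanLin A) = A.det := by
    rw [Matrix.toEuclideanLin_eq_toLin_orthonormal, LinearMap.det_toLin]
  have hlin : (volume : Measure (E d)).map (act A) = ENNReal.ofReal |A.det⁻¹| • volume := by
    rw [← hdet]
    exact Measure.map_linearMap_addHaar_eq_smul_addHaar volume (hdet ▸ hA.ne_zero)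
  have haff : (volume : Measure (E d)).map (fun y => ξ + act A y) =
      (volume.map (act A)).map fun z => ξ + z :=
    (Measure.map_map (measurable_const_add ξ) (measurable_act A)).symm
  rw [haff, hlin, Measure.map_smul, map_add_left_eq_self, smul_smul,
    ← ENNReal.ofReal_mul (abs_nonneg _), ← abs_mul, mul_inv_cancel₀ hA.ne_zero, abs_one,
    ENNReal.ofReal_one, one_smul]

end MatrixAction

noncomputable section EllipticalLaw

open Metric
open scoped ENNReal

variable {d : ℕ} {ft : ℝ → ℝ}

/-- The standard spherical distribution `Ell_d(0, 1, ft)`. -/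
def sphericalLaw (d : ℕ) (ft : ℝ → ℝ) : Measure (E d) :=
  volume.withDensity fun y => ENNReal.ofReal (normConst d ft * ft (‖y‖ ^ 2))

/-- The law of the norm of a random vector with law `sphericalLaw d ft`. -/
def radiusLaw (d : ℕ) (ft : ℝ → ℝ) : Measure ℝ :=
  (volume : Measure (E d)).toSphere univ •
    (radialMeasure (d - 1)).withDensity fun r => ENNReal.ofReal (normConst d ft * ft (r ^ 2))

instance : SFinite (radiusLaw d ft) := by
  unfold radiusLaw
  infer_instance

theorem ae_radiusLaw_pos (d : ℕ) (ft : ℝ → ℝ) : ∀ᵐ r ∂radiusLaw d ft, 0 < r :=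
  Measure.ae_smul_measure (withDensity_absolutelyContinuous _ _ (ae_radialMeasure_pos (d - 1))) _

theorem sphericalLaw_eq_map_smul (hd : 1 ≤ d) (hft : Measurable ft) :
    sphericalLaw d ft = ((radiusLaw d ft).prod (unifSphere d)).map fun p => p.1 • p.2 := by
  have : Nonempty (Fin d) := ⟨⟨0, hd⟩⟩
  have hφ : Measurable fun r : ℝ => ENNReal.ofReal (normConst d ft * ft (r ^ 2)) := by fun_prop
  rw [sphericalLaw, radiusLaw, Measure.prod_smul_left, ← Measure.prod_smul_right,
    ← surfaceMeasure_eq_smul hd]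
  simpa only [finrank_euclideanSpace, Fintype.card_fin] using
    withDensity_norm_eq_map_smul (volume : Measure (E d)) hφ

theorem isProbabilityMeasure_sphericalLaw (hft : IsDensityGenerator d ft) :
    IsProbabilityMeasure (sphericalLaw d ft) := by
  have hc : 0 ≤ normConst d ft := inv_nonneg.2 hft.pos.le
  constructor
  rw [sphericalLaw, withDensity_apply _ .univ, Measure.restrict_univ,
    ← ofReal_integral_eq_lintegral_ofReal (hft.integrable.const_mul _)
      (.of_forall fun y => mul_nonneg hc (hft.nonneg _ (sq_nonneg _))),
    integral_const_mul, normConst, inv_mul_cancel₀ hft.pos.ne', ENNReal.ofReal_one]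

theorem isProbabilityMeasure_radiusLaw (hd : 1 ≤ d) (hft : IsDensityGenerator d ft) :
    IsProbabilityMeasure (radiusLaw d ft) := by
  have := isProbabilityMeasure_unifSphere hd
  have := isProbabilityMeasure_sphericalLaw hft
  constructor
  calc radiusLaw d ft univ = ((radiusLaw d ft).prod (unifSphere d)) univ := by
        rw [← univ_prod_univ, Measure.prod_prod, measure_univ (μ := unifSphere d), mul_one]
    _ = sphericalLaw d ft univ := by
        rw [sphericalLaw_eq_map_smul hd hft.measurable,
          Measure.map_apply (by fun_prop) .univ, preimage_univ]
    _ = 1 := measure_univ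

variable {L : Matrix (Fin d) (Fin d) ℝ} {ξ : E d}

theorem ellDensity_transpose_mul_self (ξ : E d) (L : Matrix (Fin d) (Fin d) ℝ) (ft : ℝ → ℝ)
    (z : E d) :
    ellDensity ξ (Lᵀ * L) ft z = normConst d ft / |L.det| * ft (‖act Lᵀ⁻¹ (z - ξ)‖ ^ 2) := by
  rw [ellDensity, quad_inv_transpose_mul_self, Matrix.det_mul, Matrix.det_transpose,
    Real.sqrt_mul_self_eq_abs]

theorem measurable_ellDensity (ξ : E d) (L : Matrix (Fin d) (Fin d) ℝ) (hft : Measurable ft) :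
    Measurable (ellDensity ξ (Lᵀ * L) ft) := by
  have := measurable_act Lᵀ⁻¹
  simp only [funext (ellDensity_transpose_mul_self ξ L ft)]
  fun_prop

theorem ellLaw_eq_map_sphericalLaw (hL : IsUnit L.det) (hft : Measurable ft) (ξ : E d) :
    ellLaw ξ (Lᵀ * L) ft = (sphericalLaw d ft).map fun y => ξ + act Lᵀ y := by
  have hLT : IsUnit Lᵀ.det := by rwa [Matrix.det_transpose]
  have hdens := (measurable_ellDensity ξ L hft).ennreal_ofReal
  have hact := measurable_act Lᵀ
  rw [ellLaw, volume_eq_smul_map_affine hLT ξ, withDensity_smul_measure,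
    ← map_withDensity_comp _ (by fun_prop) hdens, ← Measure.map_smul,
    ← withDensity_smul' _ _ ENNReal.ofReal_ne_top, sphericalLaw]
  congr 2
  funext y
  have hdet : |L.det| ≠ 0 := abs_ne_zero.2 hL.ne_zero
  rw [Pi.smul_apply, smul_eq_mul, ← ENNReal.ofReal_mul (abs_nonneg _), Matrix.det_transpose,
    ellDensity_transpose_mul_self, add_sub_cancel_left, act_inv_act hLT, ← mul_assoc,
    mul_div_cancel₀ _ hdet]

theorem isRadiusLaw_radiusLaw (hd : 1 ≤ d) (hL : IsUnit L.det) (hft : IsDensityGenerator d ft)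
    (ξ : E d) : IsRadiusLaw ξ L (ellLaw ξ (Lᵀ * L) ft) (radiusLaw d ft) := by
  have hact := measurable_act Lᵀ
  have hpos := ae_radiusLaw_pos d ft
  simp only [ae_iff, not_lt] at hpos
  refine ⟨isProbabilityMeasure_radiusLaw hd hft, hpos, ?_⟩
  rw [ellLaw_eq_map_sphericalLaw hL hft.measurable, sphericalLaw_eq_map_smul hd hft.measurable,
    Measure.map_map (by fun_prop) (by fun_prop)]
  simp only [Function.comp_def, act_smul]

/-- Elliptical polar coordinates: the inverse of `(r, s) ↦ ξ + r • Lᵀ s`. -/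
def ellipticalPolar (ξ : E d) (L : Matrix (Fin d) (Fin d) ℝ) (z : E d) : ℝ × E d :=
  radiusDirection (act Lᵀ⁻¹ (z - ξ))

theorem measurable_ellipticalPolar (ξ : E d) (L : Matrix (Fin d) (Fin d) ℝ) :
    Measurable (ellipticalPolar ξ L) :=
  measurable_radiusDirection.comp ((measurable_act _).comp (measurable_id.sub_const ξ))

theorem leftInvOn_ellipticalPolar (hL : IsUnit L.det) :
    LeftInvOn (ellipticalPolar ξ L) (fun p : ℝ × E d => ξ + p.1 • act Lᵀ p.2)
      (Ioi 0 ×ˢ sphere 0 1) := by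
  intro p hp
  have hLT : IsUnit Lᵀ.det := by rwa [Matrix.det_transpose]
  simp only [ellipticalPolar, add_sub_cancel_left, ← act_smul, act_inv_act hLT]
  exact leftInvOn_radiusDirection_smul hp

theorem fst_ellipticalPolar (ξ : E d) (L : Matrix (Fin d) (Fin d) ℝ) (z : E d) :
    (ellipticalPolar ξ L z).1 = Real.sqrt (quad (Lᵀ * L)⁻¹ (z - ξ)) := by
  rw [quad_inv_transpose_mul_self, Real.sqrt_sq (norm_nonneg _)]
  rfl

namespace IsRadiusLaw

variable {μ : Measure (E d)} {ρ : Measure ℝ}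

theorem ae_mem_prod_sphere (h : IsRadiusLaw ξ L μ ρ) :
    ∀ᵐ p ∂ρ.prod (unifSphere d), p ∈ Ioi (0 : ℝ) ×ˢ sphere (0 : E d) 1 := by
  have := h.1
  have hpos : ∀ᵐ r ∂ρ, 0 < r := by
    simp only [ae_iff, not_lt]
    exact h.2.1
  exact _root_.ae_mem_prod_sphere hpos (ae_norm_unifSphere d)

theorem map_ellipticalPolar (h : IsRadiusLaw ξ L μ ρ) (hL : IsUnit L.det) :
    μ.map (ellipticalPolar ξ L) = ρ.prod (unifSphere d) := by
  have hact := measurable_act Lᵀ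
  have hid : ellipticalPolar ξ L ∘ (fun p : ℝ × E d => ξ + p.1 • act Lᵀ p.2)
      =ᵐ[ρ.prod (unifSphere d)] id := by
    filter_upwards [h.ae_mem_prod_sphere] with p hp using leftInvOn_ellipticalPolar hL hp
  rw [← h.2.2, Measure.map_map (measurable_ellipticalPolar ξ L) (by fun_prop),
    Measure.map_congr hid, Measure.map_id]

theorem eq_map_sqrt_quad (hd : 1 ≤ d) (h : IsRadiusLaw ξ L μ ρ) (hL : IsUnit L.det) :
    ρ = μ.map fun z => Real.sqrt (quad (Lᵀ * L)⁻¹ (z - ξ)) := by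
  have := h.1
  have := isProbabilityMeasure_unifSphere hd
  calc ρ = (ρ.prod (unifSphere d)).map Prod.fst := by
        rw [Measure.map_fst_prod, measure_univ, one_smul]
    _ = μ.map (fun z => (ellipticalPolar ξ L z).1) := by
        rw [← h.map_ellipticalPolar hL,
          Measure.map_map measurable_fst (measurable_ellipticalPolar ξ L)]
        rfl
    _ = _ := by simp only [fst_ellipticalPolar]

theorem unique (hd : 1 ≤ d) {L' : Matrix (Fin d) (Fin d) ℝ} {ρ' : Measure ℝ}
    (h : IsRadiusLaw ξ L μ ρ) (h' : IsRadiusLaw ξ L' μ ρ') (hL : IsUnit L.det)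
    (hLL' : L'ᵀ * L' = Lᵀ * L) : ρ = ρ' := by
  have hdet : IsUnit (L'ᵀ * L').det := by
    rw [hLL', Matrix.det_mul, Matrix.det_transpose]
    exact hL.mul hL
  have hL' := isUnit_det_of_transpose_mul_self hdet
  rw [h.eq_map_sqrt_quad hd hL, h'.eq_map_sqrt_quad hd hL', hLL']

theorem exists_representation (h : IsRadiusLaw ξ L μ ρ) (hd : 1 ≤ d) (hL : IsUnit L.det)
    {g : E d → ℝ≥0∞} (hg : Measurable g) {Ω : Type*} [MeasurableSpace Ω] {P : Measure Ω}
    {Z : Ω → E d} (hZ : Measurable Z) (hZg : P.map Z = μ.withDensity fun z => g (z - ξ)) :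
    ∃ (R : Ω → ℝ) (S' : Ω → E d), Measurable R ∧ Measurable S' ∧
      (∀ ω, 0 < R ω) ∧ (∀ ω, ‖S' ω‖ = 1) ∧ (∀ᵐ ω ∂P, Z ω = ξ + R ω • act Lᵀ (S' ω)) ∧
      P.map (fun ω => (R ω, S' ω)) =
        (ρ.prod (unifSphere d)).withDensity fun p => g (act Lᵀ (p.1 • p.2)) := by
  have hact := measurable_act Lᵀ
  have : Nonempty (Fin d) := ⟨⟨0, hd⟩⟩
  have hne : (Ioi (0 : ℝ) ×ˢ sphere (0 : E d) 1).Nonempty :=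
    nonempty_Ioi.prod (NormedSpace.sphere_nonempty.2 zero_le_one)
  rw [← h.2.2] at hZg
  obtain ⟨F, hF, hFmem, hZF, hFlaw⟩ := exists_measurable_lift_of_leftInvOn hne
    h.ae_mem_prod_sphere (by fun_prop) (measurable_ellipticalPolar ξ L)
    (leftInvOn_ellipticalPolar hL) (by fun_prop) hZ hZg
  refine ⟨fun ω => (F ω).1, fun ω => (F ω).2, hF.fst, hF.snd, fun ω => (hFmem ω).1,
    fun ω => mem_sphere_zero_iff_norm.1 (hFmem ω).2, hZF, ?_⟩
  simpa only [Function.comp_def, add_sub_cancel_left, ← act_smul] using hFlaw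

end IsRadiusLaw

theorem withDensity_two_mul_ellDensity (ξ : E d) (L : Matrix (Fin d) (Fin d) ℝ)
    (hft : Measurable ft) {g : E d → ℝ} (hg : Measurable g) (hg0 : ∀ y, 0 ≤ g y) :
    volume.withDensity (fun z => ENNReal.ofReal (2 * ellDensity ξ (Lᵀ * L) ft z * g (z - ξ))) =
      (ellLaw ξ (Lᵀ * L) ft).withDensity fun z => ENNReal.ofReal (2 * g (z - ξ)) := by
  rw [ellLaw, ← withDensity_mul _ (measurable_ellDensity ξ L hft).ennreal_ofReal (by fun_prop)]
  congr 1
  funext z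
  rw [Pi.mul_apply, ← ENNReal.ofReal_mul' (mul_nonneg zero_le_two (hg0 _)), mul_comm 2, mul_assoc]

end EllipticalLaw

section Perturbation

open scoped ENNReal

theorem lintegral_two_mul_odd_eq_one {V : Type*} [AddGroup V] [MeasurableSpace V] [MeasurableNeg V]
    {σ : Measure V} [IsProbabilityMeasure σ] [σ.IsNegInvariant] {G : ℝ → ℝ} (hG : Measurable G)
    (hG0 : ∀ x, 0 ≤ G x) (hGneg : ∀ x, G (-x) = 1 - G x) {v : V → ℝ} (hv : Measurable v)
    (hodd : ∀ y, v (-y) = -v y) : ∫⁻ s, ENNReal.ofReal (2 * G (v s)) ∂σ = 1 := by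
  have hG1 : ∀ x, G x ≤ 1 := fun x => by linarith [hG0 (-x), hGneg x]
  have hf : Measurable fun s => ENNReal.ofReal (2 * G (v s)) := by fun_prop
  have hpair (s : V) : ENNReal.ofReal (2 * G (v s)) + ENNReal.ofReal (2 * G (v (-s))) = 2 := by
    have := hG1 (v s)
    rw [hodd, hGneg, ← ENNReal.ofReal_add (by linarith [hG0 (v s)]) (by linarith), ← mul_add,
      add_sub_cancel, mul_one, ENNReal.ofReal_ofNat]
  have htwo : 2 * ∫⁻ s, ENNReal.ofReal (2 * G (v s)) ∂σ = 2 * 1 := by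
    rw [two_mul]
    conv_lhs => enter [2]; rw [← lintegral_neg_eq_self]
    rw [← lintegral_add_left hf, lintegral_congr hpair, lintegral_const, measure_univ]
  exact (ENNReal.mul_right_inj two_ne_zero ENNReal.ofNat_ne_top).1 htwo

variable {α β Ω : Type*} [MeasurableSpace α] [MeasurableSpace β] [MeasurableSpace Ω]
  {P : Measure Ω}

theorem ofReal_two_mul_prod_real_le [IsFiniteMeasure P] (ν : Measure ℝ) [IsProbabilityMeasure ν]
    {Y : Ω → α} (hY : Measurable Y) {v : α → ℝ} (hv : Measurable v) :
    ENNReal.ofReal (2 * (P.prod ν).real {p | p.2 ≤ v (Y p.1)}) =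
      ∫⁻ y, ENNReal.ofReal (2 * cdf ν (v y)) ∂(P.map Y) := by
  have hcdf : Measurable (cdf ν) := (monotone_cdf ν).measurable
  have hset : MeasurableSet {p : Ω × ℝ | p.2 ≤ v (Y p.1)} :=
    measurableSet_le (by fun_prop) (by fun_prop)
  simp only [ENNReal.ofReal_mul zero_le_two]
  rw [lintegral_const_mul _ (by fun_prop), lintegral_map (by fun_prop) hY, ofReal_measureReal,
    Measure.prod_apply hset]
  simp only [ofReal_cdf]
  rfl

theorem measurable_prod_real_le [SFinite P] (ν : Measure ℝ) [SFinite ν] {X : Ω → α}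
    (hX : Measurable X) {v : α × β → ℝ} (hv : Measurable v) :
    Measurable fun b => (P.prod ν).real {p | p.2 ≤ v (X p.1, b)} := by
  have hset : MeasurableSet {q : β × Ω × ℝ | q.2.2 ≤ v (X q.2.1, q.1)} :=
    measurableSet_le (by fun_prop) (by fun_prop)
  exact (measurable_measure_prodMk_left hset).ennreal_toReal

theorem map_eq_withDensity_two_mul_prod_real_le [IsFiniteMeasure P] (ν : Measure ℝ)
    [IsProbabilityMeasure ν] {X : Ω → α} {Y : Ω → β} (hX : Measurable X) (hY : Measurable Y)
    {σ : Measure β} [SFinite σ] {v : α × β → ℝ} (hv : Measurable v)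
    (hXY : P.map (fun ω => (X ω, Y ω)) =
      ((P.map X).prod σ).withDensity fun p => ENNReal.ofReal (2 * cdf ν (v p))) :
    P.map Y = σ.withDensity fun b =>
      ENNReal.ofReal (2 * (P.prod ν).real {p | p.2 ≤ v (X p.1, b)}) := by
  have hcdf : Measurable (cdf ν) := (monotone_cdf ν).measurable
  have h := congrArg (Measure.map Prod.snd) hXY
  rw [Measure.map_map measurable_snd (hX.prodMk hY),
    map_snd_prod_withDensity _ _ (by fun_prop)] at h
  refine h.trans (congrArg _ (funext fun b => ?_))
  exact (ofReal_two_mul_prod_real_le ν hX (v := fun a => v (a, b)) (by fun_prop)).symm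

variable {d : ℕ}

theorem measurable_wL {w : E d → ℝ} (hw : Measurable w) (L : Matrix (Fin d) (Fin d) ℝ) :
    Measurable (wL w L) :=
  hw.comp (measurable_act Lᵀ)

theorem wL_smul_neg {w : E d → ℝ} (hodd : ∀ y, w (-y) = -w y) (L : Matrix (Fin d) (Fin d) ℝ)
    (r : ℝ) (y : E d) : wL w L (r • -y) = -wL w L (r • y) := by
  rw [wL, wL, smul_neg, act_neg, hodd]

theorem isSymmetricPerturbation_withDensity {μ₀ : Measure (E d)} [IsProbabilityMeasure μ₀]
    [μ₀.IsNegInvariant] {G : ℝ → ℝ} (hG : Measurable G) (hG0 : ∀ x, 0 ≤ G x)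
    (hGneg : ∀ x, G (-x) = 1 - G x) {v : E d → ℝ} (hv : Measurable v)
    (hodd : ∀ y, v (-y) = -v y) :
    IsSymmetricPerturbation μ₀ G v (μ₀.withDensity fun y => ENNReal.ofReal (2 * G (v y))) := by
  refine ⟨inferInstance, Measure.map_neg_eq_self μ₀, hv, hodd, ⟨?_⟩, rfl⟩
  rw [withDensity_apply _ .univ, setLIntegral_univ,
    lintegral_two_mul_odd_eq_one hG hG0 hGneg hv hodd]

theorem exists_representation_of_skewElliptical [IsFiniteMeasure P] (hd : 1 ≤ d) {ξ : E d}
    {L : Matrix (Fin d) (Fin d) ℝ} (hL : IsUnit L.det) {ft : ℝ → ℝ} (hft : IsDensityGenerator d ft)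
    {G : ℝ → ℝ} (hG : Measurable G) (hG0 : ∀ x, 0 ≤ G x) (hGneg : ∀ x, G (-x) = 1 - G x)
    {w : E d → ℝ} (hw : Measurable w) (hodd : ∀ y, w (-y) = -w y) {Z : Ω → E d} (hZ : Measurable Z)
    (hZd : P.map Z = volume.withDensity
      (fun z => ENNReal.ofReal (2 * ellDensity ξ (Lᵀ * L) ft z * G (w (z - ξ))))) :
    ∃ (R : Ω → ℝ) (S' : Ω → E d), Measurable R ∧ Measurable S' ∧
      (∀ ω, 0 < R ω) ∧ (∀ ω, ‖S' ω‖ = 1) ∧ (∀ᵐ ω ∂P, Z ω = ξ + R ω • act Lᵀ (S' ω)) ∧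
      IsRadiusLaw ξ L (ellLaw ξ (Lᵀ * L) ft) (P.map R) ∧
      P.map (fun ω => (R ω, S' ω)) = ((P.map R).prod (unifSphere d)).withDensity
        (fun p => ENNReal.ofReal (2 * G (wL w L (p.1 • p.2)))) ∧
      ∀ᵐ r ∂P.map R, condDistrib S' R P r =
        (unifSphere d).withDensity fun s => ENNReal.ofReal (2 * G (wL w L (r • s))) := by
  have := isProbabilityMeasure_unifSphere hd
  have := isNegInvariant_unifSphere hd
  have hrad := isRadiusLaw_radiusLaw hd hL hft ξ
  have hwL := measurable_wL hw L
  rw [withDensity_two_mul_ellDensity ξ L hft.measurable (g := fun y => G (w y)) (by fun_prop)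
    fun y => hG0 _] at hZd
  obtain ⟨R, S', hR, hS', hRpos, hSnorm, hZRS, hRS⟩ := hrad.exists_representation hd hL
    (g := fun y => ENNReal.ofReal (2 * G (w y))) (by fun_prop) hZ hZd
  have hk : Measurable fun p : ℝ × E d => ENNReal.ofReal (2 * G (wL w L (p.1 • p.2))) := by fun_prop
  have hmass (r : ℝ) : ∫⁻ s, ENNReal.ofReal (2 * G (wL w L (r • s))) ∂unifSphere d = 1 :=
    lintegral_two_mul_odd_eq_one hG hG0 hGneg (v := fun s => wL w L (r • s)) (by fun_prop)
      (wL_smul_neg hodd L r)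
  have hRlaw := map_eq_of_map_prodMk_eq_withDensity hR hS' hk hmass hRS
  have hcond := condDistrib_ae_eq_withDensity hR hS' hk hmass hRS
  rw [← hRlaw] at hrad hRS
  exact ⟨R, S', hR, hS', hRpos, hSnorm, hZRS, hrad, hRS, hcond⟩

end Perturbation

theorem proposition8 (d : ℕ) (hd : 1 ≤ d)
    (ξ : E d) (Om : Matrix (Fin d) (Fin d) ℝ) (hOm : Om.PosDef)
    (ft : ℝ → ℝ) (hft : IsDensityGenerator d ft)
    -- `νX` is the law of `X`, and `G = cdf νX` its distribution function
    (νX : Measure ℝ) [IsProbabilityMeasure νX]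
    (hG : ∀ x, cdf νX (-x) = 1 - cdf νX x)
    (w : E d → ℝ) (hw : Measurable w) (hodd : ∀ y, w (-y) = -w y)
    {Ω : Type*} [MeasurableSpace Ω] (P : Measure Ω) [IsProbabilityMeasure P]
    (Z : Ω → E d) (hZ : Measurable Z)
    (hZd : P.map Z = volume.withDensity
      (fun z => ENNReal.ofReal (2 * ellDensity ξ Om ft z * cdf νX (w (z - ξ)))))
    (L : Matrix (Fin d) (Fin d) ℝ) (hL : Lᵀ * L = Om) :
    ∃ (R : Ω → ℝ) (S' : Ω → E d), Measurable R ∧ Measurable S' ∧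
      -- the stochastic representation
      (∀ ω, 0 < R ω) ∧ (∀ ω, ‖S' ω‖ = 1) ∧
      (∀ᵐ ω ∂P, Z ω = ξ + R ω • act Lᵀ (S' ω)) ∧
      -- `R` has the law of the radius of `U`
      IsRadiusLaw ξ L (ellLaw ξ Om ft) (P.map R) ∧
      (∀ (L' : Matrix (Fin d) (Fin d) ℝ) (ρ : Measure ℝ), L'ᵀ * L' = Om →
        IsRadiusLaw ξ L' (ellLaw ξ Om ft) ρ → P.map R = ρ) ∧
      -- the law of `S'` relative to the uniform law; when it is uniform
      P.map S' = (unifSphere d).withDensity (fun s =>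
        ENNReal.ofReal (2 * (P.prod νX).real {p | p.2 ≤ wL w L (R p.1 • s)})) ∧
      (P.map S' = unifSphere d ↔
        ∀ᵐ s ∂(unifSphere d), (P.prod νX).real {p | p.2 ≤ wL w L (R p.1 • s)} = 1 / 2) ∧
      -- the density of `S'` in spherical coordinates
      (2 ≤ d → HasSphericalDensity (P.map S') (fun θ =>
        Real.Gamma (d / 2) / Real.pi ^ ((d : ℝ) / 2) * angleJacobian θ *
          (P.prod νX).real {p | p.2 ≤ wLStar w L θ (R p.1)})) ∧
      -- the conditional law of `S'` given `R = r`
      (∀ᵐ r ∂(P.map R),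
        IsSymmetricPerturbation (unifSphere d) (cdf νX) (fun s => wL w L (r • s))
          (condDistrib S' R P r) ∧
        (2 ≤ d → HasSphericalDensity (condDistrib S' R P r) (fun θ =>
          Real.Gamma (d / 2) / Real.pi ^ ((d : ℝ) / 2) * angleJacobian θ *
            cdf νX (wLStar w L θ r)))) := by
  subst hL
  have hL := isUnit_det_of_transpose_mul_self hOm.det_pos.ne'.isUnit
  have := isProbabilityMeasure_unifSphere hd
  have := isNegInvariant_unifSphere hd
  have hcdf : Measurable (cdf νX) := (monotone_cdf νX).measurable
  have hwL := measurable_wL hw L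
  have hwLp : Measurable fun p : ℝ × E d => wL w L (p.1 • p.2) := by fun_prop
  obtain ⟨R, S', hR, hS', hRpos, hSnorm, hZRS, hrad, hRS, hcond⟩ :=
    exists_representation_of_skewElliptical hd hL hft hcdf (cdf_nonneg νX) hG hw hodd hZ hZd
  have hS'law := map_eq_withDensity_two_mul_prod_real_le νX hR hS' hwLp hRS
  have hprob := measurable_prod_real_le (P := P) νX hR hwLp
  have hpert (r : ℝ) := isSymmetricPerturbation_withDensity (μ₀ := unifSphere d) hcdf
    (cdf_nonneg νX) hG (v := fun s => wL w L (r • s)) (by fun_prop) (wL_smul_neg hodd L r)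
  refine ⟨R, S', hR, hS', hRpos, hSnorm, hZRS, hrad,
    fun L' ρ hL' hρ => hrad.unique hd hρ hL hL', hS'law,
    hS'law ▸ withDensity_two_mul_eq_self_iff hprob,
    fun hd2 => hS'law ▸ hasSphericalDensity_withDensity hd2 hprob, ?_⟩
  filter_upwards [hcond] with r hr
  rw [hr]
  exact ⟨hpert r, fun hd2 => hasSphericalDensity_withDensity hd2
    (p := fun s => cdf νX (wL w L (r • s))) (by fun_prop)⟩
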